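/- Herman's algorithm runs on a ring of $N\ge 1$ processors, each of which holds at most one token, the number of tokens being odd. At each time step, simultaneously, each processor that holds a token independently keeps it or passes it to the next processor in the ring, with probability $\frac12$ each; if a kept token and a received token meet at a processor, both are annihilated. A state is stable if exactly one token is left, and the stabilisation time $T$ is the first time at which the state is stable. A time step that begins in a state with $m$ tokens has cost $\frac{m-1}{2}$, and the total cost $C$ is the sum of the costs of all time steps. Let the algorithm start from any state with $2s+1$ tokens ($s\ge 0$). Then \[ \mathbb{E}(C)\le\left(1-\frac{1}{(2s+1)^{2}}\right)\frac{N^2}{6}. \] Moreover $T\le C$ almost surely, and consequently $\mathbb{E}(T)\le \frac{N^2}{6}$. -/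

import Mathlib

open MeasureTheory
open scoped ENNReal

namespace Herman

/-- A state of a ring of `N` processors, labelled by `ZMod N` so that the successor of processor
`p` is `p + 1`: the set of processors that hold a token. -/
abbrev State (N : ℕ) : Type := Finset (ZMod N)

/-- The state reached from `A` when the tokens at the positions in `M` (a subset of `A`) are passed
to the next processor and the others are kept: two tokens that meet at a processor annihilate. -/
def move {N : ℕ} (A M : State N) : State N :=
  symmDiff (A \ M) (M.image (fun p => p + 1))

/-- The one-step law of Herman's algorithm from the state `A`: each processor that has a token
independently keeps it or passes it on, with probability `1 / 2` each, which means that the set `M`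
of tokens that are passed on is uniformly distributed among the subsets of `A`. -/
noncomputable def step {N : ℕ} (A : State N) : PMF (State N) :=
  (PMF.uniformOfFinset A.powerset ⟨∅, Finset.empty_mem_powerset A⟩).map (move A)

/-- The random states `A 0, A 1, …` on the probability space `(Ω, μ)` form a run of Herman's
algorithm from the state `A₀`: a Markov chain started at `A₀` with one-step law `step`. -/
structure IsRun {N : ℕ} {Ω : Type*} [MeasurableSpace Ω] (μ : Measure Ω)
    (A₀ : State N) (A : ℕ → Ω → State N) : Prop where
  measurable : ∀ (t : ℕ) (x : State N), MeasurableSet {ω | A t ω = x}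
  start : ∀ᵐ ω ∂μ, A 0 ω = A₀
  law : ∀ (t : ℕ) (x : ℕ → State N),
    μ {ω | ∀ i ≤ t + 1, A i ω = x i} =
      μ {ω | ∀ i ≤ t, A i ω = x i} * step (x t) (x (t + 1))

/-- The cost `(m - 1) / 2` of a time step that begins in a state with `m` tokens. (A run from a
state with an odd number of tokens almost surely has `m` odd, so `1 ≤ m`, at all times.) -/
noncomputable def stepCost {N : ℕ} (A : State N) : ℝ≥0∞ :=
  ((A.card : ℝ≥0∞) - 1) / 2

/-- The total cost of a sequence of states, in `[0, ∞]`. -/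
noncomputable def totalCost {N : ℕ} (A : ℕ → State N) : ℝ≥0∞ :=
  ∑' t, stepCost (A t)

/-- The stabilisation time: the first time at which there is exactly one token
(`∞` if there is no such time). -/
noncomputable def stabTime {N : ℕ} (A : ℕ → State N) : ℝ≥0∞ :=
  ⨅ (t : ℕ) (_ : (A t).card = 1), (t : ℝ≥0∞)

end Herman

/-!
Record a state with an odd number of tokens by a sequence `σ` of signs along the ring that changes
at each token; going once around the ring reverses the sign. Up to a global sign, passing on the
tokens in `M` flips the sign that follows each token in `M` and no other. These flips are
independent, so the second moments of the window sums `W p = σ p + ⋯ + σ (p + N - 1)` can be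
computed exactly: a step from a state with `m` tokens increases the mean of the window energy
`∑ p, W p ^ 2` by `N * (m - 1)`. Hence the potential `(N ^ 2 + 2) / 6 - (∑ p, W p ^ 2) / (2 * N)`
decreases on average by exactly the cost `(m - 1) / 2` of the step.

At a state of minimal potential the mean decrease must vanish. Such a state has a single token and
potential `0`, so the potential is nonnegative, and summing the decreases bounds the expected total
cost by the initial potential. To bound the latter, compare `u = W / 2`, which moves by one unit in
the direction `-σ`, with the odd cubic `b ^ 2 * x - x ^ 3 / 3`, frozen outside `[-b, b]`: only the
`m` places where `σ` changes contribute to the summation by parts, each at most `4 * b ^ 3 / 3`, and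
`b = N / (2 * m)` is the optimal choice.

Finally `T ≤ C`, because a step that begins with at least three tokens costs at least `1`.
-/

namespace Herman

open Finset Function

section PeriodicSequences

theorem sum_range_add_of_periodic {M : Type*} [AddCommMonoid M] {N : ℕ} {g : ℕ → M}
    (hg : Periodic g N) (d : ℕ) : ∑ p ∈ range N, g (p + d) = ∑ p ∈ range N, g p := by
  induction d with
  | zero => rfl
  | succ d ih =>
    rw [← ih]
    cases N with
    | zero => rfl
    | succ n =>
      rw [sum_range_succ, sum_range_succ' (fun p => g (p + d)),
        show n + (d + 1) = 0 + d + (n + 1) by ring, hg]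
      simp only [add_right_comm, add_assoc]

/-- The sum of a sequence over the window of length `N` that starts at `p`. -/
def windowSum (N : ℕ) (σ : ℕ → ℝ) (p : ℕ) : ℝ :=
  ∑ j ∈ range N, σ (p + j)

/-- The sum of the squares of all window sums over one period. It serves as a Lyapunov function of
Herman's algorithm, with `σ` the sequence of signs that changes at each token. -/
def windowEnergy (N : ℕ) (σ : ℕ → ℝ) : ℝ :=
  ∑ p ∈ range N, windowSum N σ p ^ 2

variable {N : ℕ} {σ : ℕ → ℝ}

theorem windowSum_succ (hσ : Antiperiodic σ N) (p : ℕ) :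
    windowSum N σ (p + 1) = windowSum N σ p - 2 * σ p := by
  have h_last := sum_range_succ (fun j => σ (p + j)) N
  have h_first := sum_range_succ' (fun j => σ (p + j)) N
  simp only [hσ p, add_zero, ← add_assoc, add_right_comm p _ 1] at h_last h_first
  simp only [windowSum]
  linarith

theorem antiperiodic_windowSum (hσ : Antiperiodic σ N) : Antiperiodic (windowSum N σ) N :=
  fun p => by simp only [windowSum, add_right_comm p N, hσ _, sum_neg_distrib]

theorem sum_windowSum_sq_add (hσ : Antiperiodic σ N) (d : ℕ) :
    ∑ p ∈ range N, windowSum N σ (p + d) ^ 2 = windowEnergy N σ :=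
  sum_range_add_of_periodic (g := fun p => windowSum N σ p ^ 2)
    (fun p => by simp only [antiperiodic_windowSum hσ p, neg_sq]) d

theorem sum_windowSum_mul_self (hσ : Antiperiodic σ N) :
    ∑ p ∈ range N, windowSum N σ p * σ p = ∑ p ∈ range N, σ p ^ 2 := by
  have h_expand : ∀ p, windowSum N σ (p + 1) ^ 2 =
      windowSum N σ p ^ 2 + 4 * (σ p ^ 2 - windowSum N σ p * σ p) := fun p => by
    rw [windowSum_succ hσ]; ring
  have h_shift := sum_windowSum_sq_add hσ 1
  simp only [h_expand, sum_add_distrib, ← mul_sum, sum_sub_distrib] at h_shift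
  rw [windowEnergy] at h_shift
  linarith

theorem windowSum_add_of_const (hσ : Antiperiodic σ N) {a : ℕ} {c : ℝ}
    (hc : ∀ j < N, σ (a + j) = c) {j : ℕ} (hj : j ≤ N) :
    windowSum N σ (a + j) = (N - 2 * j) * c := by
  induction j with
  | zero =>
    rw [add_zero, windowSum, sum_congr rfl fun i hi => hc i (mem_range.1 hi)]
    simp
  | succ j ih =>
    rw [← add_assoc, windowSum_succ hσ, ih (by omega), hc j (by omega)]
    push_cast
    ring

theorem sum_range_sq_sub_two_mul (x : ℝ) (n : ℕ) :
    ∑ j ∈ range n, (x - 2 * j) ^ 2 =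
      n * x ^ 2 - 2 * n * (n - 1) * x + 2 * n * (n - 1) * (2 * n - 1) / 3 := by
  induction n with
  | zero => simp
  | succ n ih => rw [sum_range_succ, ih]; push_cast; ring

theorem windowEnergy_of_const (hσ : Antiperiodic σ N) {a : ℕ} {c : ℝ}
    (hc : ∀ j < N, σ (a + j) = c) : windowEnergy N σ = N * (N ^ 2 + 2) / 3 * c ^ 2 := by
  have h_window : ∀ j ∈ range N, windowSum N σ (j + a) ^ 2 = (N - 2 * j) ^ 2 * c ^ 2 :=
    fun j hj => by
      rw [add_comm, windowSum_add_of_const hσ hc (mem_range.1 hj).le, mul_pow]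
  rw [← sum_windowSum_sq_add hσ a, sum_congr rfl h_window, ← sum_mul, sum_range_sq_sub_two_mul]
  ring

end PeriodicSequences

section LowerBound

/-- The odd primitive of the positive part of `t ↦ b ^ 2 - t ^ 2`: the cubic
`b ^ 2 * x - x ^ 3 / 3`, made constant outside its increasing range `[-b, b]`. -/
noncomputable def truncatedCubic (b x : ℝ) : ℝ :=
  ∫ t in (0 : ℝ)..x, max (b ^ 2 - t ^ 2) 0

theorem truncatedCubic_neg (b x : ℝ) : truncatedCubic b (-x) = -truncatedCubic b x := by
  have h := intervalIntegral.integral_comp_neg (a := 0) (b := x)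
    fun t : ℝ => max (b ^ 2 - t ^ 2) 0
  simp only [neg_sq, neg_zero] at h
  rw [truncatedCubic, intervalIntegral.integral_symm, ← h, truncatedCubic]

theorem truncatedCubic_sub (b x y : ℝ) :
    truncatedCubic b y - truncatedCubic b x = ∫ t in x..y, max (b ^ 2 - t ^ 2) 0 :=
  intervalIntegral.integral_interval_sub_left
    (Continuous.intervalIntegrable (by fun_prop) _ _)
    (Continuous.intervalIntegrable (by fun_prop) _ _)

theorem integral_sq_sub_sq (b x y : ℝ) :
    ∫ t in x..y, (b ^ 2 - t ^ 2) = b ^ 2 * y - y ^ 3 / 3 - (b ^ 2 * x - x ^ 3 / 3) := by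
  rw [intervalIntegral.integral_sub (by simp) (Continuous.intervalIntegrable (by fun_prop) _ _),
    intervalIntegral.integral_const, integral_pow, smul_eq_mul]
  norm_num
  ring

theorem cubic_sub_cubic_le_truncatedCubic_sub (b : ℝ) {x y : ℝ} (hxy : x ≤ y) :
    b ^ 2 * y - y ^ 3 / 3 - (b ^ 2 * x - x ^ 3 / 3) ≤ truncatedCubic b y - truncatedCubic b x := by
  rw [truncatedCubic_sub, ← integral_sq_sub_sq]
  exact intervalIntegral.integral_mono_on hxy
    (Continuous.intervalIntegrable (by fun_prop) _ _)
    (Continuous.intervalIntegrable (by fun_prop) _ _) fun t _ => le_max_left _ _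

theorem truncatedCubic_self {b : ℝ} (hb : 0 ≤ b) : truncatedCubic b b = 2 * b ^ 3 / 3 := by
  have h_eq : Set.EqOn (fun t => max (b ^ 2 - t ^ 2) 0) (fun t => b ^ 2 - t ^ 2) (Set.uIcc 0 b) :=
    fun t ht => by
      rw [Set.uIcc_of_le hb] at ht
      exact max_eq_left (by nlinarith [ht.1, ht.2])
  rw [truncatedCubic, intervalIntegral.integral_congr h_eq, integral_sq_sub_sq]
  ring

theorem truncatedCubic_le {b : ℝ} (hb : 0 ≤ b) (x : ℝ) : truncatedCubic b x ≤ 2 * b ^ 3 / 3 := by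
  rw [← truncatedCubic_self hb, ← sub_nonneg, truncatedCubic_sub]
  rcases le_total x b with hx | hx
  · exact intervalIntegral.integral_nonneg hx fun t _ => le_max_right _ _
  · have h_eq : Set.EqOn (fun t => max (b ^ 2 - t ^ 2) 0) (fun _ => 0) (Set.uIcc x b) :=
      fun t ht => by
        rw [Set.uIcc_of_ge hx] at ht
        exact max_eq_right (by nlinarith [ht.1])
    rw [intervalIntegral.integral_congr h_eq, intervalIntegral.integral_zero]

theorem abs_truncatedCubic_le {b : ℝ} (hb : 0 ≤ b) (x : ℝ) :
    |truncatedCubic b x| ≤ 2 * b ^ 3 / 3 :=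
  abs_le.2 ⟨by linarith [truncatedCubic_le hb (-x), truncatedCubic_neg b x],
    truncatedCubic_le hb x⟩

/-- The left-hand side is the integral of `b ^ 2 - t ^ 2` between `u - s` and `u`. -/
theorem sq_sub_le_sign_mul_truncatedCubic_sub (b u : ℝ) {s : ℝ} (hs : s ^ 2 = 1) :
    b ^ 2 - (u ^ 2 - u * s + 1 / 3) ≤ s * (truncatedCubic b u - truncatedCubic b (u - s)) := by
  rcases sq_eq_one_iff.1 hs with rfl | rfl
  · linear_combination cubic_sub_cubic_le_truncatedCubic_sub b (sub_le_self u zero_le_one)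
  · linear_combination cubic_sub_cubic_le_truncatedCubic_sub b (x := u) (y := u - -1) (by linarith)

theorem sign_sub_mul_truncatedCubic_le {b : ℝ} (hb : 0 ≤ b) (u : ℝ) {s r : ℝ} (hs : s ^ 2 = 1)
    (hr : r ^ 2 = 1) : (r - s) * truncatedCubic b u ≤ 2 * b ^ 3 / 3 * (1 - s * r) := by
  have h_abs := abs_le.1 (abs_truncatedCubic_le hb u)
  rcases sq_eq_one_iff.1 hs with rfl | rfl <;>
    rcases sq_eq_one_iff.1 hr with rfl | rfl <;> linarith

variable {N : ℕ} {σ : ℕ → ℝ}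

theorem sum_sign_mul_truncatedCubic_sub (hσ : Antiperiodic σ N) {u : ℕ → ℝ}
    (hu : Antiperiodic u N) (b : ℝ) :
    ∑ p ∈ range N, σ p * (truncatedCubic b (u p) - truncatedCubic b (u (p + 1))) =
      ∑ p ∈ range N, (σ (p + 1) - σ p) * truncatedCubic b (u (p + 1)) := by
  have h_shift : ∑ p ∈ range N, σ (p + 1) * truncatedCubic b (u (p + 1)) =
      ∑ p ∈ range N, σ p * truncatedCubic b (u p) :=
    sum_range_add_of_periodic (g := fun p => σ p * truncatedCubic b (u p))
      (fun p => by simp only [hσ p, hu p, truncatedCubic_neg, neg_mul_neg]) 1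
  simp only [mul_sub, sub_mul, sum_sub_distrib, h_shift]

theorem le_windowEnergy_of_nonneg (hσ : Antiperiodic σ N) (hsign : ∀ n, σ n ^ 2 = 1) {b : ℝ}
    (hb : 0 ≤ b) :
    N * b ^ 2 - 2 * b ^ 3 / 3 * ∑ p ∈ range N, (1 - σ p * σ (p + 1)) ≤
      windowEnergy N σ / 4 - N / 6 := by
  set u : ℕ → ℝ := fun p => windowSum N σ p / 2 with hu_def
  have hu : Antiperiodic u N := fun p => by
    simp only [hu_def, antiperiodic_windowSum hσ p, neg_div]
  have hu_succ : ∀ p, u (p + 1) = u p - σ p := fun p => by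
    simp only [hu_def, windowSum_succ hσ]
    ring
  have h_sum : ∑ p ∈ range N, (b ^ 2 - (u p ^ 2 - u p * σ p + 1 / 3)) =
      N * b ^ 2 - (windowEnergy N σ / 4 - N / 6) := by
    have h_cross := sum_windowSum_mul_self hσ
    simp only [hsign, sum_const, card_range, nsmul_eq_mul, mul_one] at h_cross
    simp only [hu_def, div_pow, div_mul_eq_mul_div, sum_sub_distrib, sum_add_distrib, ← sum_div,
      h_cross, sum_const, card_range, nsmul_eq_mul, windowEnergy]
    ring
  have h_bound : ∑ p ∈ range N, (b ^ 2 - (u p ^ 2 - u p * σ p + 1 / 3)) ≤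
      2 * b ^ 3 / 3 * ∑ p ∈ range N, (1 - σ p * σ (p + 1)) :=
    calc ∑ p ∈ range N, (b ^ 2 - (u p ^ 2 - u p * σ p + 1 / 3))
      _ ≤ ∑ p ∈ range N, σ p * (truncatedCubic b (u p) - truncatedCubic b (u (p + 1))) :=
        sum_le_sum fun p _ =>
          hu_succ p ▸ sq_sub_le_sign_mul_truncatedCubic_sub b (u p) (hsign p)
      _ = ∑ p ∈ range N, (σ (p + 1) - σ p) * truncatedCubic b (u (p + 1)) :=
        sum_sign_mul_truncatedCubic_sub hσ hu b
      _ ≤ ∑ p ∈ range N, 2 * b ^ 3 / 3 * (1 - σ p * σ (p + 1)) :=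
        sum_le_sum fun p _ => sign_sub_mul_truncatedCubic_le hb _ (hsign p) (hsign _)
      _ = 2 * b ^ 3 / 3 * ∑ p ∈ range N, (1 - σ p * σ (p + 1)) := (mul_sum _ _ _).symm
  linarith

theorem le_windowEnergy (hσ : Antiperiodic σ N) (hsign : ∀ n, σ n ^ 2 = 1) {m : ℝ} (hm : 0 < m)
    (hm_sum : ∑ p ∈ range N, σ p * σ (p + 1) = N - 2 * m) :
    N ^ 3 / (3 * m ^ 2) + 2 * N / 3 ≤ windowEnergy N σ := by
  -- `b = N / (2 * m)` maximises the lower bound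
  have h := le_windowEnergy_of_nonneg hσ hsign (b := N / (2 * m)) (by positivity)
  rw [sum_sub_distrib, hm_sum, sum_const, card_range, nsmul_eq_mul, mul_one] at h
  have h_value : N * (N / (2 * m)) ^ 2 - 2 * (N / (2 * m)) ^ 3 / 3 * (N - (N - 2 * m)) =
      N ^ 3 / (3 * m ^ 2) / 4 := by
    field_simp
    ring
  linarith

end LowerBound

section SetSign

variable {α : Type*} [DecidableEq α]

/-- The sign `-1` on a set and `1` off it. -/
def setSign (A : Finset α) (z : α) : ℝ :=
  if z ∈ A then -1 else 1

theorem setSign_of_mem {A : Finset α} {z : α} (hz : z ∈ A) : setSign A z = -1 :=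
  if_pos hz

theorem setSign_of_notMem {A : Finset α} {z : α} (hz : z ∉ A) : setSign A z = 1 :=
  if_neg hz

theorem setSign_sq (A : Finset α) (z : α) : setSign A z ^ 2 = 1 := by
  unfold setSign; split_ifs <;> norm_num

theorem setSign_symmDiff (A B : Finset α) (z : α) :
    setSign (symmDiff A B) z = setSign A z * setSign B z := by
  by_cases hA : z ∈ A <;> by_cases hB : z ∈ B <;> simp [setSign, mem_symmDiff, hA, hB]

theorem prod_setSign [Fintype α] (A : Finset α) : ∏ z, setSign A z = (-1) ^ #A := by
  simp [setSign]

theorem sum_setSign [Fintype α] (A : Finset α) :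
    ∑ z, setSign A z = Fintype.card α - 2 * #A := by
  have h_indicator : ∀ z, setSign A z = 1 - 2 * (if z ∈ A then 1 else 0) := fun z => by
    unfold setSign; split_ifs <;> norm_num
  simp [h_indicator, mul_comm]

/-- For a uniformly random `M ⊆ A` the signs `setSign M z`, `z ∈ A`, are independent and centred:
this is the second moment of a constant plus a linear combination of them. -/
theorem sum_powerset_sq_add_sum_mul_setSign (A : Finset α) (c : α → ℝ) (a : ℝ) :
    ∑ M ∈ A.powerset, (a + ∑ z ∈ A, c z * setSign M z) ^ 2 =
      2 ^ #A * (a ^ 2 + ∑ z ∈ A, c z ^ 2) := by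
  induction A using Finset.induction_on generalizing a with
  | empty => simp
  | insert x A hx ih =>
    have h_keep : ∀ M ∈ A.powerset, a + ∑ z ∈ insert x A, c z * setSign M z =
        a + c x + ∑ z ∈ A, c z * setSign M z := fun M hM => by
      rw [sum_insert hx, setSign_of_notMem fun hxM => hx (mem_powerset.1 hM hxM)]
      ring
    have h_pass : ∀ M, a + ∑ z ∈ insert x A, c z * setSign (insert x M) z =
        a - c x + ∑ z ∈ A, c z * setSign M z := fun M => by
      have h_congr : ∀ z ∈ A, c z * setSign (insert x M) z = c z * setSign M z := fun z hz => by
        simp only [setSign, mem_insert, ne_of_mem_of_not_mem hz hx, false_or]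
      rw [sum_insert hx, setSign_of_mem (mem_insert_self x M), sum_congr rfl h_congr]
      ring
    rw [sum_powerset_insert hx, sum_congr rfl fun M hM => congrArg (· ^ 2) (h_keep M hM)]
    simp only [h_pass]
    rw [ih, ih, card_insert_of_notMem hx, sum_insert hx]
    ring

theorem sum_powerset_sq_sum_mul_setSign [Fintype α] (A : Finset α) (c : α → ℝ) :
    ∑ M ∈ A.powerset, (∑ z, c z * setSign M z) ^ 2 =
      2 ^ #A * ((∑ z, c z * (1 + setSign A z) / 2) ^ 2 + ∑ z ∈ A, c z ^ 2) := by
  have h_const : ∑ z, c z * (1 + setSign A z) / 2 = ∑ z ∈ Aᶜ, c z := by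
    have h_mem : ∀ z ∈ A, c z * (1 + setSign A z) / 2 = 0 := fun z hz => by
      rw [setSign_of_mem hz]; ring
    have h_compl : ∀ z ∈ Aᶜ, c z * (1 + setSign A z) / 2 = c z := fun z hz => by
      rw [setSign_of_notMem (mem_compl.1 hz)]; ring
    rw [← sum_compl_add_sum A, sum_congr rfl h_compl, sum_eq_zero h_mem, add_zero]
  rw [h_const, ← sum_powerset_sq_add_sum_mul_setSign]
  refine sum_congr rfl fun M hM => ?_
  rw [← sum_compl_add_sum A fun z => c z * setSign M z]
  have h_fixed : ∀ z ∈ Aᶜ, c z * setSign M z = c z := fun z hz => by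
    rw [setSign_of_notMem fun hzM => mem_compl.1 hz (mem_powerset.1 hM hzM), mul_one]
  rw [sum_congr rfl h_fixed]

end SetSign

section Spin

variable {N : ℕ}

/-- The sign that changes at each token met on the way from the processor `0` to the processor
`n`. -/
def spin (A : State N) (n : ℕ) : ℝ :=
  ∏ j ∈ range n, setSign A (j : ZMod N)

theorem spin_succ (A : State N) (n : ℕ) : spin A (n + 1) = spin A n * setSign A (n : ZMod N) :=
  prod_range_succ _ _

theorem spin_sq (A : State N) (n : ℕ) : spin A n ^ 2 = 1 := by
  simp [spin, ← prod_pow, setSign_sq]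

@[to_additive]
theorem prod_range_eq_prod_zmod [NeZero N] {M : Type*} [CommMonoid M] (f : ℕ → M) :
    ∏ j ∈ range N, f j = ∏ z : ZMod N, f z.val := by
  cases N with
  | zero => exact absurd rfl (NeZero.ne 0)
  | succ n => exact (Fin.prod_univ_eq_prod_range f (n + 1)).symm

theorem sum_range_add_eq_sum_zmod [NeZero N] {M : Type*} [AddCommMonoid M] (f : ℕ → ZMod N → M)
    (a : ZMod N) : ∑ j ∈ range N, f j (a + j) = ∑ z, f (z - a).val z := by
  rw [sum_range_eq_sum_zmod]
  exact Fintype.sum_equiv (Equiv.addLeft a) _ _ fun z => by simp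

theorem antiperiodic_spin [NeZero N] {A : State N} (hA : Odd #A) : Antiperiodic (spin A) N := by
  intro n
  induction n with
  | zero =>
    rw [zero_add, spin, prod_range_eq_prod_zmod]
    simp [prod_setSign, hA.neg_one_pow, spin]
  | succ n ih => rw [add_right_comm, spin_succ, ih, spin_succ]; simp

theorem sum_spin_mul_spin_succ [NeZero N] (A : State N) :
    ∑ p ∈ range N, spin A p * spin A (p + 1) = N - 2 * #A := by
  simp only [spin_succ, ← mul_assoc, ← sq, spin_sq, one_mul]
  rw [sum_range_eq_sum_zmod]
  simp [sum_setSign, ZMod.card]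

theorem windowEnergy_spin_singleton [NeZero N] (z : ZMod N) :
    windowEnergy N (spin {z}) = N * (N ^ 2 + 2) / 3 := by
  have h_const : ∀ j < N, spin {z} (z.val + 1 + j) = spin {z} (z.val + 1) := by
    intro j hj
    induction j with
    | zero => rfl
    | succ j ih =>
      have h_ne : ((z.val + 1 + j : ℕ) : ZMod N) ∉ ({z} : State N) := fun h => by
        have h_zero : ((j + 1 : ℕ) : ZMod N) = 0 := by
          have h_add := mem_singleton.1 h
          push_cast [ZMod.natCast_zmod_val] at h_add ⊢
          linear_combination h_add
        exact absurd (Nat.le_of_dvd j.succ_pos ((ZMod.natCast_eq_zero_iff _ _).1 h_zero))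
          (not_le.2 hj)
      rw [← add_assoc, spin_succ, setSign_of_notMem h_ne, mul_one, ih (by omega)]
  rw [windowEnergy_of_const (antiperiodic_spin (card_singleton z ▸ odd_one)) h_const, spin_sq,
    mul_one]

theorem setSign_move {A M : State N} (hM : M ⊆ A) (z : ZMod N) :
    setSign (move A M) z = setSign A z * setSign M z * setSign M (z - 1) := by
  have h_image : setSign (M.image fun p => p + 1) z = setSign M (z - 1) := by
    simp [setSign, sub_eq_add_neg]
  rw [move, setSign_symmDiff, ← symmDiff_of_ge hM, setSign_symmDiff, h_image]

theorem spin_move {A M : State N} (hM : M ⊆ A) (n : ℕ) :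
    spin (move A M) n = setSign M (-1) * (spin A n * setSign M ((n : ZMod N) - 1)) := by
  induction n with
  | zero => simp [spin, ← sq, setSign_sq]
  | succ n ih =>
    rw [spin_succ, ih, setSign_move hM, spin_succ, Nat.cast_succ, add_sub_cancel_right]
    linear_combination setSign M (-1) * spin A n * setSign A (n : ZMod N) *
      setSign M (n : ZMod N) * setSign_sq M ((n : ZMod N) - 1)

theorem odd_card_move [NeZero N] {A M : State N} (hM : M ⊆ A) (hA : Odd #A) :
    Odd #(move A M) := by
  have h_shift : ∏ z, setSign M (z - 1) = ∏ z, setSign M z :=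
    (Equiv.subRight (1 : ZMod N)).prod_comp (setSign M)
  have h_sign : (-1 : ℝ) ^ #(move A M) = -1 := by
    rw [← prod_setSign, prod_congr rfl fun z _ => setSign_move hM z, prod_mul_distrib,
      prod_mul_distrib, h_shift, mul_assoc, ← sq, ← prod_pow, prod_setSign, hA.neg_one_pow]
    simp [setSign_sq]
  exact (neg_one_pow_eq_neg_one_iff_odd (by norm_num)).1 h_sign

theorem windowSum_spin_move_sq [NeZero N] {A M : State N} (hM : M ⊆ A) (p : ℕ) :
    windowSum N (spin (move A M)) (p + 1) ^ 2 =
      (∑ z : ZMod N, spin A (p + 1 + (z - p).val) * setSign M z) ^ 2 := by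
  have h_term : ∀ j : ℕ, spin (move A M) (p + 1 + j) =
      setSign M (-1) * (spin A (p + 1 + j) * setSign M (p + j : ZMod N)) := fun j => by
    rw [spin_move hM]; push_cast; ring_nf
  simp only [windowSum, h_term, ← mul_sum]
  rw [mul_pow, setSign_sq, one_mul,
    sum_range_add_eq_sum_zmod fun j z => spin A (p + 1 + j) * setSign M z]

theorem sum_powerset_windowSum_sq [NeZero N] {A : State N} (hA : Odd #A) (p : ℕ) :
    ∑ M ∈ A.powerset, windowSum N (spin (move A M)) (p + 1) ^ 2 =
      2 ^ #A * ((windowSum N (spin A) p - spin A p) ^ 2 + #A) := by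
  have h_term : ∀ j : ℕ, spin A (p + 1 + j) * (1 + setSign A (p + j : ZMod N)) / 2 =
      (spin A (p + 1 + j) + spin A (p + j)) / 2 := fun j => by
    have h_sq := setSign_sq A (p + j : ZMod N)
    rw [add_right_comm, spin_succ]
    push_cast
    linear_combination spin A (p + j) / 2 * h_sq
  have h_mean : ∑ z : ZMod N, spin A (p + 1 + (z - p).val) * (1 + setSign A z) / 2 =
      windowSum N (spin A) p - spin A p := by
    rw [← sum_range_add_eq_sum_zmod fun j z => spin A (p + 1 + j) * (1 + setSign A z) / 2,
      sum_congr rfl fun j _ => h_term j, ← sum_div, sum_add_distrib]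
    change (windowSum N (spin A) (p + 1) + windowSum N (spin A) p) / 2 = _
    rw [windowSum_succ (antiperiodic_spin hA)]
    ring
  rw [sum_congr rfl fun M hM => windowSum_spin_move_sq (mem_powerset.1 hM) p,
    sum_powerset_sq_sum_mul_setSign, h_mean]
  simp [spin_sq]

theorem sum_powerset_windowEnergy [NeZero N] {A : State N} (hA : Odd #A) :
    ∑ M ∈ A.powerset, windowEnergy N (spin (move A M)) =
      2 ^ #A * (windowEnergy N (spin A) + N * (#A - 1)) := by
  have hσ := antiperiodic_spin hA
  have h_shift : ∀ M ∈ A.powerset, windowEnergy N (spin (move A M)) =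
      ∑ p ∈ range N, windowSum N (spin (move A M)) (p + 1) ^ 2 := fun M hM =>
    (sum_windowSum_sq_add (antiperiodic_spin (odd_card_move (mem_powerset.1 hM) hA)) 1).symm
  rw [sum_congr rfl h_shift, sum_comm,
    sum_congr rfl fun p _ => sum_powerset_windowSum_sq hA p, ← mul_sum]
  simp only [sub_sq, mul_assoc, sum_add_distrib, sum_sub_distrib, ← mul_sum,
    sum_windowSum_mul_self hσ, spin_sq, sum_const, card_range, nsmul_eq_mul, windowEnergy]
  ring

end Spin

section Potential

variable {N : ℕ}

/-- The Lyapunov function of Herman's algorithm: an affine function of the window energy that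
decreases on average by exactly the cost of each step and vanishes at the states with one token. -/
noncomputable def potential (A : State N) : ℝ :=
  ((N : ℝ) ^ 2 + 2) / 6 - windowEnergy N (spin A) / (2 * N)

variable [NeZero N]

theorem sum_powerset_potential {A : State N} (hA : Odd #A) :
    ∑ M ∈ A.powerset, potential (move A M) = 2 ^ #A * (potential A - ((#A : ℝ) - 1) / 2) := by
  have hN : (N : ℝ) ≠ 0 := NeZero.ne _
  simp only [potential, sum_sub_distrib, ← sum_div, sum_powerset_windowEnergy hA, sum_const,
    card_powerset, nsmul_eq_mul]
  field_simp
  push_cast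
  ring

theorem potential_eq_zero_of_card_eq_one {A : State N} (hA : #A = 1) : potential A = 0 := by
  have hN : (N : ℝ) ≠ 0 := NeZero.ne _
  obtain ⟨z, rfl⟩ := card_eq_one.1 hA
  rw [potential, windowEnergy_spin_singleton]
  field_simp
  ring

theorem potential_nonneg {A : State N} (hA : Odd #A) : 0 ≤ potential A := by
  -- At a minimum of the potential the average decrease must vanish, so there is just one token.
  obtain ⟨B, hB, h_min⟩ := exists_min_image {B : State N | Odd #B} potential ⟨A, by simpa using hA⟩
  simp only [mem_filter_univ] at hB h_min
  have h_sum : 2 ^ #B * potential B ≤ 2 ^ #B * (potential B - ((#B : ℝ) - 1) / 2) :=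
    calc 2 ^ #B * potential B = ∑ _M ∈ B.powerset, potential B := by simp
      _ ≤ ∑ M ∈ B.powerset, potential (move B M) :=
        sum_le_sum fun M hM => h_min _ (odd_card_move (mem_powerset.1 hM) hB)
      _ = _ := sum_powerset_potential hB
  have h_card_le : (#B : ℝ) ≤ 1 := by linarith [le_of_mul_le_mul_left h_sum (by positivity)]
  have h_card : #B = 1 := le_antisymm (by exact_mod_cast h_card_le) hB.pos
  exact (potential_eq_zero_of_card_eq_one h_card).symm.trans_le (h_min A hA)

theorem potential_le {A : State N} (hA : Odd #A) :
    potential A ≤ (1 - 1 / (#A : ℝ) ^ 2) * (N : ℝ) ^ 2 / 6 := by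
  have hN : (0 : ℝ) < N := by exact_mod_cast NeZero.pos N
  have hm : (0 : ℝ) < #A := by exact_mod_cast hA.pos
  have h_energy := le_windowEnergy (antiperiodic_spin hA) (spin_sq A) hm (sum_spin_mul_spin_succ A)
  calc potential A
    _ ≤ ((N : ℝ) ^ 2 + 2) / 6 - (N ^ 3 / (3 * (#A : ℝ) ^ 2) + 2 * N / 3) / (2 * N) := by
      rw [potential]; gcongr
    _ = _ := by field_simp; ring

end Potential

section Drift

variable {N : ℕ}

theorem stepCost_eq_ofReal (A : State N) : stepCost A = ENNReal.ofReal (((#A : ℝ) - 1) / 2) := by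
  rw [stepCost, ENNReal.ofReal_div_of_pos two_pos, ENNReal.ofReal_sub _ zero_le_one]
  simp

variable [NeZero N] {A : State N}

theorem sum_step_mul (A : State N) (V : State N → ℝ≥0∞) :
    ∑ y, step A y * V y = ((2 : ℝ≥0∞) ^ #A)⁻¹ * ∑ M ∈ A.powerset, V (move A M) := by
  have h_step : step A = (PMF.uniformOfFinset A.powerset (powerset_nonempty A)).map (move A) := rfl
  simp only [h_step, PMF.map_apply, PMF.uniformOfFinset_apply, tsum_fintype, sum_mul, ite_mul,
    zero_mul]
  rw [sum_comm]
  simp [mul_sum, -mem_powerset, sum_ite_mem]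

theorem odd_card_of_mem_support_step (hA : Odd #A) {B : State N} (hB : B ∈ (step A).support) :
    Odd #B := by
  obtain ⟨M, hM, rfl⟩ := (PMF.mem_support_map_iff _ _ _).1 hB
  exact odd_card_move (mem_powerset.1 ((PMF.mem_support_uniformOfFinset_iff _ _).1 hM)) hA

theorem sum_step_mul_potential_add_stepCost (hA : Odd #A) :
    ∑ y, step A y * ENNReal.ofReal (potential y) + stepCost A = ENNReal.ofReal (potential A) := by
  have h_move_nonneg : ∀ M ∈ A.powerset, 0 ≤ potential (move A M) := fun M hM =>
    potential_nonneg (odd_card_move (mem_powerset.1 hM) hA)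
  have h_mean_nonneg : 0 ≤ potential A - ((#A : ℝ) - 1) / 2 := by
    have h_sum_nonneg := sum_nonneg h_move_nonneg
    rw [sum_powerset_potential hA] at h_sum_nonneg
    exact nonneg_of_mul_nonneg_right h_sum_nonneg (by positivity)
  have h_cost_nonneg : 0 ≤ ((#A : ℝ) - 1) / 2 :=
    div_nonneg (sub_nonneg.2 (Nat.one_le_cast.2 hA.pos)) zero_le_two
  rw [sum_step_mul, ← ENNReal.ofReal_sum_of_nonneg h_move_nonneg, sum_powerset_potential hA,
    ENNReal.ofReal_mul (by positivity), ENNReal.ofReal_pow zero_le_two, ENNReal.ofReal_ofNat,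
    ENNReal.inv_mul_cancel_left (by simp) (by simp), stepCost_eq_ofReal,
    ← ENNReal.ofReal_add h_mean_nonneg h_cost_nonneg, sub_add_cancel]

end Drift

section Run

variable {Ω : Type*} [MeasurableSpace Ω]

theorem measurable_comp_of_measurableSet_fiber {ι β : Type*} [Countable ι] [MeasurableSpace β]
    {F : Ω → ι} (hF : ∀ i, MeasurableSet {ω | F ω = i}) (g : ι → β) :
    Measurable fun ω => g (F ω) :=
  let _ : MeasurableSpace ι := ⊤
  measurable_from_top.comp (measurable_to_countable' hF)

theorem lintegral_comp_of_measurableSet_fiber {ι : Type*} [Fintype ι] (μ : Measure Ω) {F : Ω → ι}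
    (hF : ∀ i, MeasurableSet {ω | F ω = i}) (g : ι → ℝ≥0∞) :
    ∫⁻ ω, g (F ω) ∂μ = ∑ i, μ {ω | F ω = i} * g i := by
  let _ : MeasurableSpace ι := ⊤
  have : MeasurableSingletonClass ι := ⟨fun _ => trivial⟩
  rw [← lintegral_map measurable_from_top (measurable_to_countable' hF), lintegral_fintype]
  simp only [Measure.map_apply (measurable_to_countable' hF) (MeasurableSet.singleton _), mul_comm]
  rfl

theorem tsum_le_of_forall_add_le {a c : ℕ → ℝ≥0∞} (h : ∀ n, a (n + 1) + c n ≤ a n) :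
    ∑' n, c n ≤ a 0 := by
  have h_partial : ∀ n, a n + ∑ k ∈ range n, c k ≤ a 0 := fun n => by
    induction n with
    | zero => simp
    | succ n ih =>
      calc a (n + 1) + ∑ k ∈ range (n + 1), c k = a (n + 1) + c n + ∑ k ∈ range n, c k := by
            rw [sum_range_succ, add_comm (∑ k ∈ range n, c k), add_assoc]
        _ ≤ a n + ∑ k ∈ range n, c k := by gcongr; exact h n
        _ ≤ a 0 := ih
  exact ENNReal.tsum_le_of_sum_range_le fun n => le_add_self.trans (h_partial n)

namespace IsRun

variable {N : ℕ} {μ : Measure Ω} {A₀ : State N} {A : ℕ → Ω → State N}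

theorem measurableSet_path (hA : IsRun μ A₀ A) {n : ℕ} (w : Fin n → State N) :
    MeasurableSet {ω | (fun i : Fin n => A i ω) = w} := by
  simp only [funext_iff, Set.ofPred_forall]
  exact .iInter fun i => hA.measurable i (w i)

theorem measure_path_snoc (hA : IsRun μ A₀ A) (t : ℕ) (w : Fin (t + 1) → State N) (y : State N) :
    μ {ω | (fun i : Fin (t + 2) => A i ω) = Fin.snoc w y} =
      μ {ω | (fun i : Fin (t + 1) => A i ω) = w} * step (w (Fin.last t)) y := by
  have h_law := hA.law t fun i => if h : i < t + 1 then w ⟨i, h⟩ else y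
  have h_init : ∀ ω, (∀ i ≤ t, A i ω = if h : i < t + 1 then w ⟨i, h⟩ else y) ↔
      (fun i : Fin (t + 1) => A i ω) = w := fun ω => by
    simp +contextual [funext_iff, Fin.forall_iff]
  have h_all : ∀ ω, (∀ i ≤ t + 1, A i ω = if h : i < t + 1 then w ⟨i, h⟩ else y) ↔
      (fun i : Fin (t + 2) => A i ω) = Fin.snoc w y := fun ω => by
    simp [funext_iff, Fin.forall_iff, Nat.lt_succ_iff, Fin.snoc, Fin.castLT]
  simp only [h_init, h_all] at h_law
  simpa [Fin.last] using h_law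

variable [NeZero N]

theorem lintegral_succ (hA : IsRun μ A₀ A) (t : ℕ) (V : State N → ℝ≥0∞) :
    ∫⁻ ω, V (A (t + 1) ω) ∂μ = ∫⁻ ω, ∑ y, step (A t ω) y * V y ∂μ :=
  calc ∫⁻ ω, V (A (t + 1) ω) ∂μ
    _ = ∑ w : Fin (t + 2) → State N,
          μ {ω | (fun i : Fin (t + 2) => A i ω) = w} * V (w (Fin.last (t + 1))) :=
      lintegral_comp_of_measurableSet_fiber μ hA.measurableSet_path
        fun w => V (w (Fin.last (t + 1)))
    _ = ∑ w : Fin (t + 1) → State N, μ {ω | (fun i : Fin (t + 1) => A i ω) = w} *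
          ∑ y, step (w (Fin.last t)) y * V y := by
      rw [← (Fin.snocEquiv fun _ => State N).sum_comp, Fintype.sum_prod_type_right]
      simp [Fin.snocEquiv, hA.measure_path_snoc, mul_sum, mul_assoc]
    _ = ∫⁻ ω, ∑ y, step (A t ω) y * V y ∂μ :=
      (lintegral_comp_of_measurableSet_fiber μ hA.measurableSet_path
        fun w => ∑ y, step (w (Fin.last t)) y * V y).symm

theorem ae_forall_of_invariant (hA : IsRun μ A₀ A) {P : State N → Prop} (h_start : P A₀)
    (h_step : ∀ x, P x → ∀ y ∈ (step x).support, P y) : ∀ᵐ ω ∂μ, ∀ t, P (A t ω) := by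
  classical
  refine ae_all_iff.2 fun t => ?_
  induction t with
  | zero => filter_upwards [hA.start] with ω hω using hω ▸ h_start
  | succ t ih =>
    have h_lintegral : ∫⁻ ω, (if P (A (t + 1) ω) then 0 else 1 : ℝ≥0∞) ∂μ = 0 := by
      rw [hA.lintegral_succ t fun y => if P y then 0 else 1]
      refine lintegral_eq_zero_of_ae_eq_zero ?_
      filter_upwards [ih] with ω hω
      refine sum_eq_zero fun y _ => ?_
      by_cases hy : y ∈ (step (A t ω)).support
      · rw [if_pos (h_step _ hω y hy), mul_zero]
      · rw [(PMF.apply_eq_zero_iff _ _).2 hy, zero_mul]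
    have h_measurable := measurable_comp_of_measurableSet_fiber (hA.measurable (t + 1))
      fun y => (if P y then 0 else 1 : ℝ≥0∞)
    filter_upwards [(lintegral_eq_zero_iff h_measurable).1 h_lintegral] with ω hω
    simpa using hω

theorem ae_odd_card (hA : IsRun μ A₀ A) (h_odd : Odd #A₀) : ∀ᵐ ω ∂μ, ∀ t, Odd #(A t ω) :=
  hA.ae_forall_of_invariant (P := fun x => Odd #x) h_odd fun _ hx _ hy =>
    odd_card_of_mem_support_step hx hy

theorem lintegral_potential_succ (hA : IsRun μ A₀ A) (h_odd : Odd #A₀) (t : ℕ) :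
    ∫⁻ ω, ENNReal.ofReal (potential (A (t + 1) ω)) ∂μ + ∫⁻ ω, stepCost (A t ω) ∂μ =
      ∫⁻ ω, ENNReal.ofReal (potential (A t ω)) ∂μ := by
  rw [hA.lintegral_succ t fun y => ENNReal.ofReal (potential y),
    ← lintegral_add_right _ (measurable_comp_of_measurableSet_fiber (hA.measurable t) stepCost)]
  refine lintegral_congr_ae ?_
  filter_upwards [hA.ae_odd_card h_odd] with ω hω using sum_step_mul_potential_add_stepCost (hω t)

theorem lintegral_totalCost_le [IsProbabilityMeasure μ] (hA : IsRun μ A₀ A) (h_odd : Odd #A₀) :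
    ∫⁻ ω, totalCost (fun t => A t ω) ∂μ ≤ ENNReal.ofReal (potential A₀) := by
  have h_start : ∀ᵐ ω ∂μ, ENNReal.ofReal (potential (A 0 ω)) = ENNReal.ofReal (potential A₀) := by
    filter_upwards [hA.start] with ω hω using by rw [hω]
  calc ∫⁻ ω, totalCost (fun t => A t ω) ∂μ
    _ = ∑' t, ∫⁻ ω, stepCost (A t ω) ∂μ := lintegral_tsum fun t =>
      (measurable_comp_of_measurableSet_fiber (hA.measurable t) stepCost).aemeasurable
    _ ≤ ∫⁻ ω, ENNReal.ofReal (potential (A 0 ω)) ∂μ :=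
      tsum_le_of_forall_add_le (a := fun t => ∫⁻ ω, ENNReal.ofReal (potential (A t ω)) ∂μ)
        fun t => (hA.lintegral_potential_succ h_odd t).le
    _ = ENNReal.ofReal (potential A₀) := by
      rw [lintegral_congr_ae h_start, lintegral_const, measure_univ, mul_one]

end IsRun

end Run

section StabilisationTime

variable {N : ℕ}

theorem one_le_stepCost {A : State N} (hA : Odd #A) (hne : #A ≠ 1) : 1 ≤ stepCost A := by
  have h_card : 3 ≤ #A := by obtain ⟨k, hk⟩ := hA; omega
  have h_cast : (3 : ℝ) ≤ #A := by exact_mod_cast h_card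
  rw [stepCost_eq_ofReal, ENNReal.one_le_ofReal]
  linarith

variable {A : ℕ → State N}

theorem natCast_le_totalCost (hA : ∀ t, Odd #(A t)) {n : ℕ} (hn : ∀ t < n, #(A t) ≠ 1) :
    (n : ℝ≥0∞) ≤ totalCost A :=
  calc (n : ℝ≥0∞) = ∑ t ∈ range n, 1 := by simp
    _ ≤ ∑ t ∈ range n, stepCost (A t) :=
      sum_le_sum fun t ht => one_le_stepCost (hA t) (hn t (mem_range.1 ht))
    _ ≤ totalCost A := ENNReal.sum_le_tsum _

theorem stabTime_le_totalCost (hA : ∀ t, Odd #(A t)) : stabTime A ≤ totalCost A := by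
  by_cases h_stable : ∃ t, #(A t) = 1
  · exact (iInf₂_le (Nat.find h_stable) (Nat.find_spec h_stable)).trans
      (natCast_le_totalCost hA fun t ht => Nat.find_min h_stable ht)
  · push Not at h_stable
    have h_top : totalCost A = ∞ := top_le_iff.1 <| ENNReal.iSup_natCast ▸
      iSup_le fun n => natCast_le_totalCost hA fun t _ => h_stable t
    exact h_top ▸ le_top

end StabilisationTime

end Herman

theorem mainTheorem3 {N : ℕ} [NeZero N] {Ω : Type*} [MeasurableSpace Ω]
    (μ : Measure Ω) [IsProbabilityMeasure μ] (s : ℕ) (A₀ : Herman.State N)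
    (hA₀ : A₀.card = 2 * s + 1) (A : ℕ → Ω → Herman.State N) (hA : Herman.IsRun μ A₀ A) :
    (∫⁻ ω, Herman.totalCost (fun t => A t ω) ∂μ ≤
        ENNReal.ofReal ((1 - 1 / (2 * (s : ℝ) + 1) ^ 2) * (N : ℝ) ^ 2 / 6)) ∧
      (∀ᵐ ω ∂μ, Herman.stabTime (fun t => A t ω) ≤ Herman.totalCost (fun t => A t ω)) ∧
      (∫⁻ ω, Herman.stabTime (fun t => A t ω) ∂μ ≤ ENNReal.ofReal ((N : ℝ) ^ 2 / 6)) := by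
  have h_odd : Odd A₀.card := ⟨s, hA₀⟩
  have h_cast : (A₀.card : ℝ) = 2 * s + 1 := by exact_mod_cast hA₀
  have h_cost := (hA.lintegral_totalCost_le h_odd).trans
    (ENNReal.ofReal_le_ofReal (h_cast ▸ Herman.potential_le h_odd))
  have h_time : ∀ᵐ ω ∂μ, Herman.stabTime (fun t => A t ω) ≤ Herman.totalCost fun t => A t ω := by
    filter_upwards [hA.ae_odd_card h_odd] with ω hω using Herman.stabTime_le_totalCost hω
  have h_factor : (1 - 1 / (2 * (s : ℝ) + 1) ^ 2) * (N : ℝ) ^ 2 / 6 ≤ (N : ℝ) ^ 2 / 6 := by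
    gcongr
    exact mul_le_of_le_one_left (by positivity) (sub_le_self _ (by positivity))
  exact ⟨h_cost, h_time,
    (lintegral_mono_ae h_time).trans (h_cost.trans (ENNReal.ofReal_le_ofReal h_factor))⟩
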